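/- Theorem 3.1. Let $m\ge 1$, let $f=(f_1,\dots,f_m)\colon\mathbb{R}^n\to\mathbb{R}^m$ be locally Lipschitz and let $\Omega\subset\mathbb{R}^n$ be closed. Notation. For $a,b\in\mathbb{R}^m$, $a\leqq b$ means $a_i\le b_i$ for all $i$. For $A\subset\mathbb{R}^m$ and $y\in\mathbb{R}^m$, the section of $A$ at $y$ is $[A]_y:=\{z\in A: z\leqq y\}$; it is called bounded if there is $a\in\mathbb{R}^m$ with $a\leqq z$ for all $z\in[A]_y$. For a set $S$ in a Euclidean space and $x\in S$, the regular normal cone $\widehat N(x;S)$ consists of all vectors $v$ with $\langle v,x'-x\rangle\le o(\|x'-x\|)$ as $x'\to x$, $x'\in S$. The limiting normal cone $N(x;S)$ consists of all $v$ for which there are $x^k\to x$, $x^k\in S$, and $v^k\to v$ with $v^k\in\widehat N(x^k;S)$. For $\phi\colon\mathbb{R}^n\to\mathbb{R}$, the limiting subdifferential is $\partial\phi(x):=\{v: (v,-1)\in N((x,\phi(x));\mathrm{epi}\,\phi)\}$, where $\mathrm{epi}\,\phi=\{(x,t)\in\mathbb{R}^n\times\mathbb{R}:\phi(x)\le t\}$.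 The Rabier function is, for $x\in\Omega$, $$\nu(x):=\inf\Big\{\Big\|\sum_{i=1}^m\lambda_iv^i+w\Big\| : v^i\in\partial f_i(x)\cup\partial(-f_i)(x),\ w\in N(x;\Omega),\ \lambda_i\ge0,\ \sum_{i=1}^m\lambda_i=1\Big\}.$$ Let $\Gamma(f,\Omega)$ be the set of all $x\in\Omega$ for which there are $v^i\in\partial f_i(x)\cup\partial(-f_i)(x)$, $\lambda_i\ge0$ $(i=1,\dots,m)$ and $\mu\in\mathbb{R}$ with $\sum_{i=1}^m\lambda_i+|\mu|=1$ and $0\in\sum_{i=1}^m\lambda_iv^i+\mu x+N(x;\Omega)$. For $\bar y\in\mathbb{R}^m$ let $\widetilde K_{\infty,\leqq\bar y}(f,\Omega)$ be the set of all $y\in\mathbb{R}^m$ for which there is a sequence $\{x^k\}\subset\Omega$ with $f(x^k)\leqq\bar y$ for all $k$, $\|x^k\|\to\infty$, $f(x^k)\to y$ and $\nu(x^k)\to0$. Let $K_{\infty,\leqq\bar y}(f,\Omega)$ be defined in the same way with $\|x^k\|\nu(x^k)\to0$ in place of $\nu(x^k)\to0$. Let $T_{\infty,\leqq\bar y}(f,\Omega)$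 be the set of all $y\in\mathbb{R}^m$ for which there is a sequence $\{x^k\}\subset\Gamma(f,\Omega)$ with $f(x^k)\leqq\bar y$ for all $k$, $\|x^k\|\to\infty$ and $f(x^k)\to y$. Claim. Let $\bar y\in f(\Omega)$ be such that the section $[f(\Omega)]_{\bar y}$ is bounded. Then the following are equivalent: (i) $f|_\Omega$ is proper at the sublevel $\bar y$: for every sequence $\{x^k\}\subset\Omega$ with $\|x^k\|\to\infty$ and $f(x^k)\leqq\bar y$ for all $k$, one has $\|f(x^k)\|\to\infty$; (ii) (Palais–Smale condition at $\bar y$) $\widetilde K_{\infty,\leqq\bar y}(f,\Omega)=\emptyset$; (iii) (weak Palais–Smale condition at $\bar y$) $K_{\infty,\leqq\bar y}(f,\Omega)=\emptyset$; (iv) ($M$-tameness at the sublevel $\bar y$) $T_{\infty,\leqq\bar y}(f,\Omega)=\emptyset$. Moreover, if one of these equivalent conditions holds, then $[f(\Omega)]_{\bar y}$ is nonempty and compact. -/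

import Mathlib

open Filter Topology

namespace NonsmoothVO

noncomputable section

/-- The regular (Fréchet) normal cone: all `v` with
`⟪v, y - x⟫ ≤ o(‖y - x‖)` as `y → x`, `y ∈ Ω`. -/
def regularNormalCone {H : Type*} [NormedAddCommGroup H] [InnerProductSpace ℝ H]
    (Ω : Set H) (x : H) : Set H :=
  {v | ∀ ε : ℝ, 0 < ε → ∀ᶠ y in 𝓝[Ω] x, inner ℝ v (y - x) ≤ ε * ‖y - x‖}

/-- The limiting (Mordukhovich) normal cone: limits of regular normals at points of `Ω`
converging to `x`. -/
def limitingNormalCone {H : Type*} [NormedAddCommGroup H] [InnerProductSpace ℝ H]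
    (Ω : Set H) (x : H) : Set H :=
  {v | ∃ (xs vs : ℕ → H), (∀ k, xs k ∈ Ω) ∧ Tendsto xs atTop (𝓝 x) ∧
    (∀ k, vs k ∈ regularNormalCone Ω (xs k)) ∧ Tendsto vs atTop (𝓝 v)}

/-- The epigraph of `φ`, as a subset of the Euclidean (ℓ²) product `H × ℝ`. -/
def epigraph {H : Type*} (φ : H → ℝ) : Set (WithLp 2 (H × ℝ)) :=
  {p | φ p.fst ≤ p.snd}

/-- The limiting subdifferential: all `v` such that `(v, -1)` is a limiting normal to the
epigraph of `φ` at `(x, φ x)`. -/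
def limitingSubdifferential {H : Type*} [NormedAddCommGroup H] [InnerProductSpace ℝ H]
    (φ : H → ℝ) (x : H) : Set H :=
  {v | WithLp.toLp 2 (v, (-1 : ℝ)) ∈
    limitingNormalCone (epigraph φ) (WithLp.toLp 2 (x, φ x))}

/-- The componentwise order `a ≦ b`, i.e. `b - a` lies in the nonnegative orthant. -/
def Leq {m : ℕ} (a b : EuclideanSpace ℝ (Fin m)) : Prop := ∀ i, a i ≤ b i

/-- The section of `A` at `y`: the intersection of `A` with `y - ℝ^m_+`. -/
def sectionAt {m : ℕ} (A : Set (EuclideanSpace ℝ (Fin m))) (y : EuclideanSpace ℝ (Fin m)) :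
    Set (EuclideanSpace ℝ (Fin m)) :=
  A ∩ {z | Leq z y}

/-- The section of `A` at `y` is bounded: it is contained in `a + ℝ^m_+` for some `a`. -/
def HasBoundedSection {m : ℕ} (A : Set (EuclideanSpace ℝ (Fin m)))
    (y : EuclideanSpace ℝ (Fin m)) : Prop :=
  ∃ a : EuclideanSpace ℝ (Fin m), sectionAt A y ⊆ {z | Leq a z}

variable {n m : ℕ}

/-- The restriction of `f` to `Ω` is proper at the sublevel `y`. -/
def IsProperAtSublevel (f : EuclideanSpace ℝ (Fin n) → EuclideanSpace ℝ (Fin m))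
    (Ω : Set (EuclideanSpace ℝ (Fin n))) (y : EuclideanSpace ℝ (Fin m)) : Prop :=
  ∀ x : ℕ → EuclideanSpace ℝ (Fin n), (∀ k, x k ∈ Ω) →
    Tendsto (fun k => ‖x k‖) atTop atTop → (∀ k, Leq (f (x k)) y) →
    Tendsto (fun k => ‖f (x k)‖) atTop atTop

/-- The set `∂f_i(x) ∪ ∂(-f_i)(x)`. -/
def symmetricSubdifferential (f : EuclideanSpace ℝ (Fin n) → EuclideanSpace ℝ (Fin m))
    (i : Fin m) (x : EuclideanSpace ℝ (Fin n)) : Set (EuclideanSpace ℝ (Fin n)) :=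
  limitingSubdifferential (fun z => f z i) x ∪ limitingSubdifferential (fun z => -(f z i)) x

/-- The (extended) Rabier function. The infimum is over a set of nonnegative reals, which is
nonempty when `f` is locally Lipschitz, `x ∈ Ω` and `1 ≤ m`. -/
def rabier (f : EuclideanSpace ℝ (Fin n) → EuclideanSpace ℝ (Fin m))
    (Ω : Set (EuclideanSpace ℝ (Fin n))) (x : EuclideanSpace ℝ (Fin n)) : ℝ :=
  sInf {r : ℝ | ∃ (v : Fin m → EuclideanSpace ℝ (Fin n)) (w : EuclideanSpace ℝ (Fin n))
    (l : Fin m → ℝ), (∀ i, v i ∈ symmetricSubdifferential f i x) ∧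
    w ∈ limitingNormalCone Ω x ∧ (∀ i, 0 ≤ l i) ∧ ∑ i, l i = 1 ∧
    r = ‖∑ i, l i • v i + w‖}

/-- The set of asymptotic critical values `K̃_{∞,≦y}(f, Ω)`. -/
def tildeKInfty (f : EuclideanSpace ℝ (Fin n) → EuclideanSpace ℝ (Fin m))
    (Ω : Set (EuclideanSpace ℝ (Fin n))) (ybar : EuclideanSpace ℝ (Fin m)) :
    Set (EuclideanSpace ℝ (Fin m)) :=
  {y | ∃ x : ℕ → EuclideanSpace ℝ (Fin n), (∀ k, x k ∈ Ω) ∧ (∀ k, Leq (f (x k)) ybar) ∧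
    Tendsto (fun k => ‖x k‖) atTop atTop ∧ Tendsto (fun k => f (x k)) atTop (𝓝 y) ∧
    Tendsto (fun k => rabier f Ω (x k)) atTop (𝓝 0)}

/-- The set `K_{∞,≦y}(f, Ω)`, with the weighted condition `‖x^k‖ ν(x^k) → 0`. -/
def KInfty (f : EuclideanSpace ℝ (Fin n) → EuclideanSpace ℝ (Fin m))
    (Ω : Set (EuclideanSpace ℝ (Fin n))) (ybar : EuclideanSpace ℝ (Fin m)) :
    Set (EuclideanSpace ℝ (Fin m)) :=
  {y | ∃ x : ℕ → EuclideanSpace ℝ (Fin n), (∀ k, x k ∈ Ω) ∧ (∀ k, Leq (f (x k)) ybar) ∧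
    Tendsto (fun k => ‖x k‖) atTop atTop ∧ Tendsto (fun k => f (x k)) atTop (𝓝 y) ∧
    Tendsto (fun k => ‖x k‖ * rabier f Ω (x k)) atTop (𝓝 0)}

/-- The set `Γ(f, Ω)`. -/
def Gam (f : EuclideanSpace ℝ (Fin n) → EuclideanSpace ℝ (Fin m))
    (Ω : Set (EuclideanSpace ℝ (Fin n))) : Set (EuclideanSpace ℝ (Fin n)) :=
  {x | x ∈ Ω ∧ ∃ v : Fin m → EuclideanSpace ℝ (Fin n),
    (∀ i, v i ∈ symmetricSubdifferential f i x) ∧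
    ∃ (l : Fin m → ℝ) (μ : ℝ), (∀ i, 0 ≤ l i) ∧ ∑ i, l i + |μ| = 1 ∧
    ∃ w ∈ limitingNormalCone Ω x, ∑ i, l i • v i + μ • x + w = 0}

/-- The tangency set `T_{∞,≦y}(f, Ω)`. -/
def TInfty (f : EuclideanSpace ℝ (Fin n) → EuclideanSpace ℝ (Fin m))
    (Ω : Set (EuclideanSpace ℝ (Fin n))) (ybar : EuclideanSpace ℝ (Fin m)) :
    Set (EuclideanSpace ℝ (Fin m)) :=
  {y | ∃ x : ℕ → EuclideanSpace ℝ (Fin n), (∀ k, x k ∈ Gam f Ω) ∧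
    (∀ k, Leq (f (x k)) ybar) ∧
    Tendsto (fun k => ‖x k‖) atTop atTop ∧ Tendsto (fun k => f (x k)) atTop (𝓝 y)}

/-- The Palais–Smale condition at `ybar`. -/
def PalaisSmale (f : EuclideanSpace ℝ (Fin n) → EuclideanSpace ℝ (Fin m))
    (Ω : Set (EuclideanSpace ℝ (Fin n))) (ybar : EuclideanSpace ℝ (Fin m)) : Prop :=
  tildeKInfty f Ω ybar = ∅

/-- The weak Palais–Smale condition at `ybar`. -/
def WeakPalaisSmale (f : EuclideanSpace ℝ (Fin n) → EuclideanSpace ℝ (Fin m))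
    (Ω : Set (EuclideanSpace ℝ (Fin n))) (ybar : EuclideanSpace ℝ (Fin m)) : Prop :=
  KInfty f Ω ybar = ∅

/-- M-tameness at the sublevel `ybar`. -/
def MTame (f : EuclideanSpace ℝ (Fin n) → EuclideanSpace ℝ (Fin m))
    (Ω : Set (EuclideanSpace ℝ (Fin n))) (ybar : EuclideanSpace ℝ (Fin m)) : Prop :=
  TInfty f Ω ybar = ∅

end

end NonsmoothVO

/-! Each of the four conditions is equivalent to boundedness of the sublevel set `S = {x ∈ Ω | f x ≦
ybar}`. If `S` is bounded, no admissible sequence escapes to infinity. If `S` is unbounded, the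
bounded section keeps `f` on `S` inside a compact box, so properness fails; it remains to find far
points of `S` that are nearly critical, and compactness of the box supplies the limit value.

Such points come from minimizing `∑ i, f x i` over pieces of `S`: a point dominating the minimizer
would again lie in `S`, so the minimizer is weakly Pareto optimal. On `S` intersected with a sphere
this gives points of `Gam` (`exists_mem_Gam`); an Ekeland-type perturbation gives slopes of order `ε
/ ‖x‖` (`exists_norm_mul_rabier_le`).

Both rest on the Fritz John rule `exists_multipliers`, proved without a subdifferential sum rule:
every component gets its own copy of the variable, the copies are tied together by a quadratic
penalty, and the maximum is smoothed by log-sum-exp, whose weights become the multipliers. -/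

namespace NonsmoothVO

/-! ### Regular subgradients and normals -/

section Subgradients

variable {E : Type*} [NormedAddCommGroup E] [InnerProductSpace ℝ E]

/-- `v` is a regular (Fréchet) subgradient of `φ` at `x`. -/
def IsRegularSubgradient (φ : E → ℝ) (v x : E) : Prop :=
  ∀ ε : ℝ, 0 < ε → ∀ᶠ y in 𝓝 x, inner ℝ v (y - x) ≤ φ y - φ x + ε * ‖y - x‖

theorem IsRegularSubgradient.mem_regularNormalCone {φ : E → ℝ} {v x : E}
    (h : IsRegularSubgradient φ v x) :
    WithLp.toLp 2 (v, (-1 : ℝ)) ∈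
      regularNormalCone (epigraph φ) (WithLp.toLp 2 (x, φ x)) := by
  intro ε hε
  have hfst : Tendsto (fun p : WithLp 2 (E × ℝ) => p.fst)
      (𝓝 (WithLp.toLp 2 (x, φ x))) (𝓝 x) := by
    have : Continuous (fun p : WithLp 2 (E × ℝ) => p.fst) := by fun_prop
    exact this.tendsto _
  filter_upwards [mem_nhdsWithin_of_mem_nhds (hfst.eventually (h ε hε)),
    self_mem_nhdsWithin] with p hp hpe
  have hpe' : φ p.fst ≤ p.snd := hpe
  have hn : ‖p.fst - x‖ ≤ ‖p - WithLp.toLp 2 (x, φ x)‖ :=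
    WithLp.norm_fst_le (p := 2) (α := E) (β := ℝ) (p - WithLp.toLp 2 (x, φ x))
  have hi : inner ℝ (WithLp.toLp 2 (v, (-1 : ℝ))) (p - WithLp.toLp 2 (x, φ x))
      = inner ℝ v (p.fst - x) - (p.snd - φ x) := by
    rw [WithLp.prod_inner_apply]
    simp
    ring
  rw [hi]
  have := mul_le_mul_of_nonneg_left hn hε.le
  linarith

theorem mem_limitingSubdifferential_of_tendsto {φ : E → ℝ} {x v : E} {xs vs : ℕ → E}
    (hφ : ContinuousAt φ x) (hx : Tendsto xs atTop (𝓝 x)) (hv : Tendsto vs atTop (𝓝 v))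
    (h : ∀ k, IsRegularSubgradient φ (vs k) (xs k)) : v ∈ limitingSubdifferential φ x := by
  refine ⟨fun k => WithLp.toLp 2 (xs k, φ (xs k)), fun k => WithLp.toLp 2 (vs k, -1),
    fun k => le_refl (φ (xs k)), ?_, fun k => (h k).mem_regularNormalCone, ?_⟩
  · exact ((WithLp.prod_continuous_toLp 2 E ℝ).tendsto _).comp
      (hx.prodMk_nhds (hφ.tendsto.comp hx))
  · exact ((WithLp.prod_continuous_toLp 2 E ℝ).tendsto _).comp
      (hv.prodMk_nhds tendsto_const_nhds)

/-- Test the subgradient inequality at `x + t • v` for small `t > 0`: it reads `t‖v‖² ≤ (L + ε)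
t‖v‖`. -/
theorem IsRegularSubgradient.norm_le {φ : E → ℝ} {v x : E} {L : NNReal} {s : Set E}
    (h : IsRegularSubgradient φ v x) (hs : s ∈ 𝓝 x) (hL : LipschitzOnWith L φ s) :
    ‖v‖ ≤ L := by
  refine le_of_forall_pos_le_add fun ε hε => ?_
  by_cases hv : v = 0
  · simp only [hv, norm_zero]; positivity
  have hvp : 0 < ‖v‖ := norm_pos_iff.2 hv
  have hc : Tendsto (fun t : ℝ => x + t • v) (𝓝[>] 0) (𝓝 x) := by
    have : Continuous (fun t : ℝ => x + t • v) := by fun_prop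
    simpa using (this.tendsto 0).mono_left nhdsWithin_le_nhds
  obtain ⟨t, ⟨ht1, ht2⟩, ht0⟩ :=
    (((hc.eventually (h ε hε)).and (hc.eventually hs)).and self_mem_nhdsWithin).exists
  have ht0' : (0 : ℝ) < t := ht0
  have hd := hL.dist_le_mul _ ht2 _ (mem_of_mem_nhds hs)
  rw [Real.dist_eq, dist_eq_norm] at hd
  simp only [add_sub_cancel_left, norm_smul, Real.norm_eq_abs, abs_of_pos ht0',
    inner_smul_right, real_inner_self_eq_norm_sq] at ht1 hd
  have h3 := (le_abs_self _).trans hd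
  have h4 : (t * ‖v‖) * ‖v‖ ≤ (t * ‖v‖) * (L + ε) := by nlinarith
  exact le_of_mul_le_mul_left h4 (by positivity)

theorem neg_gradient_mem_regularNormalCone {Ω : Set E} {s : E → ℝ} {g x : E}
    (hs : HasFDerivAt s (innerSL ℝ g) x) (hmin : IsLocalMinOn s Ω x) :
    -g ∈ regularNormalCone Ω x := by
  intro ε hε
  filter_upwards [hmin, mem_nhdsWithin_of_mem_nhds (hs.isLittleO.def hε)] with y hy hy2
  have hy' : s x ≤ s y := hy
  rw [Real.norm_eq_abs, innerSL_apply_apply] at hy2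
  rw [inner_neg_left]
  linarith [le_abs_self (s y - s x - inner ℝ g (y - x))]

/-- Expand `ψ` and `s` to first order at the minimum. The Lipschitz bound turns the error `o(|φ y -
φ x|)` of `ψ` into `o(‖y - x‖)`, and dividing by `d > 0` isolates `φ`. -/
theorem isRegularSubgradient_of_isLocalMin {φ s : E → ℝ} {ψ : ℝ → ℝ} {d : ℝ} {g x : E}
    {L : NNReal} {U : Set E} (hU : U ∈ 𝓝 x) (hL : LipschitzOnWith L φ U)
    (hψ : HasDerivAt ψ d (φ x)) (hd : 0 < d) (hs : HasFDerivAt s (innerSL ℝ g) x)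
    (hmin : IsLocalMin (fun y => ψ (φ y) + s y) x) :
    IsRegularSubgradient φ (-(d⁻¹ • g)) x := by
  intro ε hε
  have hc : Tendsto φ (𝓝 x) (𝓝 (φ x)) := (hL.continuousOn.continuousAt hU)
  -- Each of the two expansion errors gets the share `d * ε / 2`; `L + 1` keeps the denominator
  -- positive when `L = 0`.
  have h1 := hc.eventually (hψ.isLittleO.def (c := d * ε / (2 * (L + 1))) (by positivity))
  have h2 := hs.isLittleO.def (c := d * ε / 2) (by positivity)
  filter_upwards [hmin, h1, h2, hU] with y hy hy1 hy2 hyU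
  have hy' : ψ (φ x) + s x ≤ ψ (φ y) + s y := hy
  have hl := hL.dist_le_mul _ hyU _ (mem_of_mem_nhds hU)
  rw [Real.dist_eq, dist_eq_norm] at hl
  simp only [Real.norm_eq_abs, innerSL_apply_apply, smul_eq_mul] at hy1 hy2
  have hy3 : d * ε / (2 * (L + 1)) * |φ y - φ x| ≤ d * ε / 2 * ‖y - x‖ := by
    have : |φ y - φ x| ≤ (L + 1) * ‖y - x‖ := by nlinarith [norm_nonneg (y - x)]
    calc _ ≤ d * ε / (2 * (L + 1)) * ((L + 1) * ‖y - x‖) := by gcongr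
      _ = _ := by field_simp
  have a1 := (le_abs_self _).trans hy1
  have a2 := (le_abs_self _).trans hy2
  rw [inner_neg_left, real_inner_smul_left]
  have key : 0 ≤ d * (φ y - φ x) + inner ℝ g (y - x) + d * ε * ‖y - x‖ := by linarith
  have := mul_nonneg (inv_pos.2 hd).le key
  have e : d⁻¹ * (d * (φ y - φ x) + inner ℝ g (y - x) + d * ε * ‖y - x‖)
      = (φ y - φ x) + d⁻¹ * inner ℝ g (y - x) + ε * ‖y - x‖ := by field_simp
  linarith

end Subgradients

/-! ### Log-sum-exp smoothing of the maximum -/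

section SoftMax

variable {ι : Type*} [Fintype ι]

/-- The log-sum-exp smoothing of the maximum, with temperature `T`. -/
noncomputable def softMax (T : ℝ) (z : ι → ℝ) : ℝ := T * Real.log (∑ i, Real.exp (z i / T))

theorem le_softMax {T : ℝ} (hT : 0 < T) (z : ι → ℝ) (i : ι) : z i ≤ softMax T z := by
  have h : Real.exp (z i / T) ≤ ∑ j, Real.exp (z j / T) :=
    Finset.single_le_sum (f := fun j => Real.exp (z j / T)) (fun j _ => (Real.exp_pos _).le)
      (Finset.mem_univ i)
  have := (Real.le_log_iff_exp_le ((Real.exp_pos _).trans_le h)).2 h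
  rw [softMax]
  calc z i = T * (z i / T) := by field_simp
    _ ≤ _ := by gcongr

theorem softMax_zero (T : ℝ) : softMax T (fun _ : ι => 0) = T * Real.log (Fintype.card ι) := by
  simp [softMax]

variable [Nonempty ι]

theorem sum_exp_pos (z : ι → ℝ) : 0 < ∑ i, Real.exp (z i) :=
  Finset.sum_pos (fun _ _ => Real.exp_pos _) Finset.univ_nonempty

theorem continuous_softMax (T : ℝ) : Continuous (softMax T : (ι → ℝ) → ℝ) := by
  unfold softMax
  exact continuous_const.mul (Continuous.log (by fun_prop) fun z => (sum_exp_pos _).ne')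

theorem hasDerivAt_softMax_update [DecidableEq ι] {T : ℝ} (hT : 0 < T) (z : ι → ℝ) (i : ι) :
    HasDerivAt (fun t => softMax T (Function.update z i t))
      (Real.exp (z i / T) / ∑ j, Real.exp (z j / T)) (z i) := by
  have h1 : ∀ j ∈ Finset.univ, HasDerivAt (fun t => Real.exp (Function.update z i t j / T))
      (if j = i then Real.exp (z i / T) / T else 0) (z i) := by
    intro j _
    by_cases hj : j = i
    · subst hj
      simpa [div_eq_mul_inv] using ((hasDerivAt_id (z j)).div_const T).exp
    · simpa [Function.update_of_ne hj, hj] using hasDerivAt_const (z i) (Real.exp (z j / T))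
  have h2 := HasDerivAt.fun_sum h1
  have hpos := sum_exp_pos (fun j => z j / T)
  have h3 := (h2.log (by simpa using hpos.ne')).const_mul T
  simp only [Function.update_eq_self, Finset.sum_ite_eq', Finset.mem_univ, if_true] at h3
  refine h3.congr_deriv ?_
  field_simp

end SoftMax

/-! ### Exact localization by penalization -/

/-- Quadratic-type penalization on a compact set: minimizers of `A + K * B` get close to the
sublevel set of `A` in the zero set of `B`. -/
theorem exists_penalized_minimizer {X : Type*} [TopologicalSpace X] {C : Set X}
    (hC : IsCompact C) {A B : X → ℝ} (hA : Continuous A) (hB : Continuous B)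
    (hB0 : ∀ p, 0 ≤ B p) {p₀ : X} (hp₀ : p₀ ∈ C) (hBp₀ : B p₀ = 0) {U : Set X} (hU : IsOpen U)
    (h : ∀ p ∈ C, B p = 0 → A p ≤ A p₀ → p ∈ U) :
    ∃ K : ℝ, 0 ≤ K ∧ ∃ p ∈ C, p ∈ U ∧ ∀ p' ∈ C, A p + K * B p ≤ A p' + K * B p' := by
  -- Otherwise, for every integer weight `k`, each minimizer `p k` lies outside `U`. A cluster point
  -- `q` lies in `C \ U`, with `A q ≤ A p₀`; since `A` is bounded below on `C`, `B (p k) = O(1/k)`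
  -- and hence `B q = 0`, against `h`.
  by_contra! hcon
  have hex : ∀ k : ℕ, ∃ p ∈ C, ∀ p' ∈ C, A p + k * B p ≤ A p' + k * B p' := fun k =>
    hC.exists_isMinOn ⟨p₀, hp₀⟩ (f := fun p => A p + k * B p)
      (by fun_prop : Continuous fun p => A p + k * B p).continuousOn
  choose p hpC hpmin using hex
  have hpU : ∀ k, p k ∈ C \ U := fun k => by
    refine ⟨hpC k, fun hk => ?_⟩
    obtain ⟨p', hp', hlt⟩ := hcon k (Nat.cast_nonneg k) (p k) (hpC k) hk
    exact absurd (hpmin k p' hp') (not_le.2 hlt)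
  obtain ⟨q, hq, hqc⟩ := (hC.diff hU).exists_mapClusterPt
    (f := atTop) (u := p) (tendsto_principal.2 (Eventually.of_forall hpU))
  obtain ⟨a, ha⟩ : ∃ a, ∀ x ∈ C, a ≤ A x := by
    obtain ⟨y, _, hy⟩ := hC.exists_isMinOn ⟨p₀, hp₀⟩ hA.continuousOn
    exact ⟨A y, hy⟩
  have hle : ∀ k : ℕ, A (p k) + k * B (p k) ≤ A p₀ := fun k => by
    simpa [hBp₀] using hpmin k p₀ hp₀
  have hAq : A q ≤ A p₀ := by
    have hcl : MapClusterPt (A q) atTop (A ∘ p) := hqc.continuousAt_comp hA.continuousAt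
    refine isClosed_Iic.mem_of_mapClusterPt hcl (Eventually.of_forall fun k => ?_)
    have := mul_nonneg (Nat.cast_nonneg (α := ℝ) k) (hB0 (p k))
    simp only [Function.comp, Set.mem_Iic]
    linarith [hle k]
  have hBq : B q ≤ 0 := by
    refine le_of_forall_pos_le_add fun ε hε => ?_
    have hcl : MapClusterPt (B q) atTop (B ∘ p) := hqc.continuousAt_comp hB.continuousAt
    rw [zero_add]
    refine isClosed_Iic.mem_of_mapClusterPt hcl ?_
    obtain ⟨N, hN⟩ := exists_nat_gt ((A p₀ - a) / ε)
    filter_upwards [eventually_ge_atTop N, eventually_gt_atTop 0] with k hk hk0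
    have hk' : (N : ℝ) ≤ k := by exact_mod_cast hk
    have hk0' : (0 : ℝ) < k := by exact_mod_cast hk0
    rw [div_lt_iff₀ hε] at hN
    have h1 := hle k
    have h2 := ha _ (hpC k)
    simp only [Function.comp, Set.mem_Iic]
    refine le_of_mul_le_mul_left (a := (k : ℝ)) ?_ hk0'
    nlinarith
  exact hq.2 (h q hq.1 (le_antisymm hBq (hB0 q)) hAq)

end NonsmoothVO

namespace NonsmoothVO

/-! ### Fritz John multipliers -/

section Multipliers

variable {E : Type*} [NormedAddCommGroup E] [InnerProductSpace ℝ E]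

theorem hasFDerivAt_norm_sub_sq (a x : E) :
    HasFDerivAt (fun y => ‖y - a‖ ^ 2) (innerSL ℝ ((2 : ℝ) • (x - a))) x := by
  refine (((hasFDerivAt_id x).sub_const a).norm_sq).congr_fderiv ?_
  ext y
  simp [two_smul]

theorem smul_mem_regularNormalCone {Ω : Set E} {x v : E} {t : ℝ} (ht : 0 ≤ t)
    (hv : v ∈ regularNormalCone Ω x) : t • v ∈ regularNormalCone Ω x := by
  intro ε hε
  filter_upwards [hv (ε / (t + 1)) (by positivity)] with y hy
  rw [real_inner_smul_left]
  calc t * inner ℝ v (y - x) ≤ t * (ε / (t + 1) * ‖y - x‖) := by gcongr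
    _ = (t / (t + 1)) * (ε * ‖y - x‖) := by field_simp
    _ ≤ 1 * (ε * ‖y - x‖) := by
      gcongr
      rw [div_le_one (by positivity)]
      linarith
    _ = ε * ‖y - x‖ := one_mul _

variable {ι : Type*} [Fintype ι]

/-- The gradient of the smooth part of the penalized objective. -/
theorem hasFDerivAt_penalty (a x : E) (X : ι → E) {ε σ c r K : ℝ} (hσ : 0 < σ) :
    HasFDerivAt (fun y => ε * √(‖y - a‖ ^ 2 + σ ^ 2) + ‖y - a‖ ^ 2
        + K * ((c * (‖y‖ ^ 2 - r)) ^ 2 + ∑ i, ‖X i - y‖ ^ 2))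
      (innerSL ℝ ((ε / √(‖x - a‖ ^ 2 + σ ^ 2) + 2) • (x - a)
        + (4 * K * c * (c * (‖x‖ ^ 2 - r))) • x + (2 * K) • ∑ i, (x - X i))) x := by
  have h1 := hasFDerivAt_norm_sub_sq a x
  have hpos : ‖x - a‖ ^ 2 + σ ^ 2 ≠ 0 := by positivity
  have h2 := ((h1.add_const (σ ^ 2)).sqrt hpos).const_mul ε
  have h3 := hasFDerivAt_norm_sub_sq 0 x
  simp only [sub_zero] at h3
  have h4 := ((h3.sub_const r).const_mul c).pow 2
  have h5 : HasFDerivAt (fun y => ∑ i, ‖X i - y‖ ^ 2)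
      (∑ i, innerSL ℝ ((2 : ℝ) • (x - X i))) x := by
    refine HasFDerivAt.fun_sum fun i _ => ?_
    simpa only [norm_sub_rev] using hasFDerivAt_norm_sub_sq (X i) x
  refine ((h2.add h1).add ((h4.add h5).const_mul K)).congr_fderiv ?_
  have hs : √(‖x - a‖ ^ 2 + σ ^ 2) ≠ 0 := (Real.sqrt_pos.2 (by positivity)).ne'
  ext y
  simp [Finset.sum_sub_distrib, ← Finset.mul_sum]
  field_simp
  ring

variable [Nonempty ι] [ProperSpace E]

/-- Stationarity of one penalized problem in the variables `(x, X)`, taken one variable at a time: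
each copy `X i` yields a regular subgradient, `x` yields a regular normal, and the penalty forces
cancel in the sum. The constant `c` switches the sphere constraint on or off. -/
theorem exists_fuzzy_multipliers {F : ι → E → ℝ} (hF : ∀ i, LocallyLipschitz (F i))
    {Ω : Set E} (hΩ : IsClosed Ω) {a : E} (ha : a ∈ Ω) {ε c r δ η : ℝ} (hε : 0 ≤ ε)
    (hq : c * (‖a‖ ^ 2 - r) = 0) (hδ : 0 < δ)
    (hmin : ∀ x ∈ Ω, ‖x - a‖ ≤ δ → c * (‖x‖ ^ 2 - r) = 0 →
      ∃ i, -(ε * ‖x - a‖) ≤ F i x - F i a) (hη : 0 < η) :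
    ∃ (x : E) (X V : ι → E) (l : ι → ℝ) (μ : ℝ) (w : E), x ∈ Ω ∧ ‖x - a‖ < η ∧
      (∀ i, ‖X i - a‖ < η) ∧ (∀ i, IsRegularSubgradient (F i) (V i) (X i)) ∧
      (∀ i, 0 ≤ l i) ∧ ∑ i, l i = 1 ∧ (c = 0 → μ = 0) ∧ w ∈ regularNormalCone Ω x ∧
      ‖∑ i, l i • V i + μ • x + w‖ ≤ ε + η := by
  classical
  obtain ⟨ρ, hρ, hρδ, hρη⟩ : ∃ ρ, 0 < ρ ∧ ρ ≤ δ ∧ 2 * ρ ≤ η :=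
    ⟨min δ (η / 2), lt_min hδ (by positivity), min_le_left _ _, by
      linarith [min_le_right δ (η / 2)]⟩
  -- The smoothings `T` and `σ` raise the objective at `a` by less than `ρ ^ 2` in total, so the
  -- term `‖x - a‖ ^ 2` confines feasible competitors to the open ball of radius `ρ`.
  obtain ⟨T, hT, hTl⟩ := exists_pos_mul_lt (show 0 < ρ ^ 2 / 2 by positivity)
    (Real.log (Fintype.card ι))
  obtain ⟨σ, hσ, hσl⟩ := exists_pos_mul_lt (show 0 < ρ ^ 2 / 2 by positivity) ε
  have hFc : ∀ i, Continuous (F i) := fun i => (hF i).continuous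
  set C : Set (E × (ι → E)) := (Ω ∩ Metric.closedBall a ρ) ×ˢ
    Set.univ.pi fun _ => Metric.closedBall a ρ with hCdef
  have hC : IsCompact C := ((isCompact_closedBall a ρ).inter_left hΩ).prod
    (isCompact_univ_pi fun _ => isCompact_closedBall a ρ)
  have memC : ∀ x X, (x, X) ∈ C ↔ (x ∈ Ω ∧ ‖x - a‖ ≤ ρ) ∧ ∀ i, ‖X i - a‖ ≤ ρ := by
    intro x X
    simp [hCdef, dist_eq_norm]
  set U : Set (E × (ι → E)) := Metric.ball a ρ ×ˢ
    Set.univ.pi fun _ => Metric.ball a ρ with hUdef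
  have hU : IsOpen U := Metric.isOpen_ball.prod
    (isOpen_set_pi Set.finite_univ fun _ _ => Metric.isOpen_ball)
  have memU : ∀ x X, (x, X) ∈ U ↔ ‖x - a‖ < ρ ∧ ∀ i, ‖X i - a‖ < ρ := by
    intro x X
    simp [hUdef, dist_eq_norm]
  set A : E × (ι → E) → ℝ := fun p => softMax T (fun i => F i (p.2 i) - F i a) +
    (ε * √(‖p.1 - a‖ ^ 2 + σ ^ 2) + ‖p.1 - a‖ ^ 2) with hA
  set B : E × (ι → E) → ℝ := fun p => (c * (‖p.1‖ ^ 2 - r)) ^ 2 + ∑ i, ‖p.2 i - p.1‖ ^ 2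
    with hB
  have hAc : Continuous A := by
    refine ((continuous_softMax T).comp ?_).add (by fun_prop)
    exact continuous_pi fun i => ((hFc i).comp (by fun_prop)).sub continuous_const
  have hBc : Continuous B := by fun_prop
  have hB0 : ∀ p, 0 ≤ B p := fun p => by positivity
  have hp₀ : (a, fun _ : ι => a) ∈ C := by simp [memC, ha, hρ.le]
  have hBp₀ : B (a, fun _ : ι => a) = 0 := by simp [hB, hq]
  have hAp₀ : A (a, fun _ : ι => a) < ρ ^ 2 := by
    have : A (a, fun _ : ι => a) = T * Real.log (Fintype.card ι) + ε * σ := by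
      simp [hA, softMax_zero, Real.sqrt_sq hσ.le]
    rw [this]
    linarith [mul_comm T (Real.log (Fintype.card ι))]
  have hloc : ∀ p ∈ C, B p = 0 → A p ≤ A (a, fun _ : ι => a) → p ∈ U := by
    rintro ⟨x, X⟩ hpC hpB hpA
    rw [memC] at hpC
    have hs : 0 ≤ ∑ i, ‖X i - x‖ ^ 2 := Finset.sum_nonneg fun i _ => by positivity
    have hpB' : (c * (‖x‖ ^ 2 - r)) ^ 2 + ∑ i, ‖X i - x‖ ^ 2 = 0 := hpB
    have hqx : c * (‖x‖ ^ 2 - r) = 0 := by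
      have := sq_nonneg (c * (‖x‖ ^ 2 - r))
      exact pow_eq_zero_iff two_ne_zero |>.1 (by linarith)
    have hs0 : ∑ i, ‖X i - x‖ ^ 2 = 0 := by rw [hqx] at hpB'; simpa using hpB'
    have hX : ∀ i, X i = x := fun i => by
      have := (Finset.sum_eq_zero_iff_of_nonneg fun i _ => by positivity).1 hs0 i
        (Finset.mem_univ i)
      simpa [sub_eq_zero] using this
    obtain ⟨i, hi⟩ := hmin x hpC.1.1 (hpC.1.2.trans hρδ) hqx
    have h1 := le_softMax hT (fun i => F i (X i) - F i a) i
    simp only [hX i] at h1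
    have h2 : ‖x - a‖ ≤ √(‖x - a‖ ^ 2 + σ ^ 2) :=
      Real.le_sqrt_of_sq_le (by linarith [sq_nonneg σ])
    have h3 := mul_le_mul_of_nonneg_left h2 hε
    have h4 : ‖x - a‖ ^ 2 < ρ ^ 2 := by
      have : A (x, X) = softMax T (fun i => F i (X i) - F i a) +
        (ε * √(‖x - a‖ ^ 2 + σ ^ 2) + ‖x - a‖ ^ 2) := rfl
      linarith
    have h5 := lt_of_pow_lt_pow_left₀ 2 hρ.le h4
    rw [memU]
    exact ⟨h5, fun i => by rwa [hX i]⟩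
  obtain ⟨K, hK, ⟨x, X⟩, hpC, hpU, hpmin⟩ :=
    exists_penalized_minimizer hC hAc hBc hB0 hp₀ hBp₀ hU hloc
  rw [memC] at hpC
  rw [memU] at hpU
  set z : ι → ℝ := fun i => F i (X i) - F i a with hz
  set l : ι → ℝ := fun i => Real.exp (z i / T) / ∑ j, Real.exp (z j / T) with hl
  have hSpos := sum_exp_pos (fun j => z j / T)
  have hlpos : ∀ i, 0 < l i := fun i => div_pos (Real.exp_pos _) hSpos
  -- These are the stationarity equations: the weight `l i` times the `i`-th subgradient balances
  -- the pull `(2 * K) • (X i - x)`, and the normal is minus the gradient of the part smooth in `x`.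
  refine ⟨x, X, fun i => -((l i)⁻¹ • ((2 * K) • (X i - x))), l,
    4 * K * c * (c * (‖x‖ ^ 2 - r)),
    -((ε / √(‖x - a‖ ^ 2 + σ ^ 2) + 2) • (x - a)
        + (4 * K * c * (c * (‖x‖ ^ 2 - r))) • x + (2 * K) • ∑ i, (x - X i)),
    hpC.1.1, by linarith, fun i => by linarith [hpU.2 i], ?_, fun i => (hlpos i).le, ?_, ?_,
    ?_, ?_⟩
  · intro i
    obtain ⟨L, t, ht, hL⟩ := hF i (X i)
    refine isRegularSubgradient_of_isLocalMin (s := fun y => K * ‖y - x‖ ^ 2)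
      (ψ := fun t => softMax T (Function.update z i (t - F i a))) ht hL ?_ (hlpos i) ?_ ?_
    · exact (hasDerivAt_softMax_update hT z i).comp_sub_const (F i (X i)) (F i a)
    · refine ((hasFDerivAt_norm_sub_sq x (X i)).const_mul K).congr_fderiv ?_
      ext y
      simp
      ring
    · have hnear : ∀ᶠ y in 𝓝 (X i), ‖y - a‖ < ρ :=
        (by fun_prop : Continuous fun y => ‖y - a‖).continuousAt.eventually
          (gt_mem_nhds (hpU.2 i))
      filter_upwards [hnear] with y hy
      -- Only the `i`-th copy moves, so every other term of the objective is constant.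
      have hmem : (x, Function.update X i y) ∈ C := by
        rw [memC]
        refine ⟨hpC.1, fun j => ?_⟩
        rcases eq_or_ne j i with rfl | hj
        · simpa using hy.le
        · simpa [hj] using hpC.2 j
      have h1 := hpmin _ hmem
      have e1 : (fun j => F j (Function.update X i y j) - F j a)
          = Function.update z i (F i y - F i a) := by
        ext j
        rcases eq_or_ne j i with rfl | hj <;> simp [*]
      have e2 : ∀ u : E, ∑ j, ‖Function.update X i u j - x‖ ^ 2
          = ‖u - x‖ ^ 2 + ∑ j ∈ Finset.univ \ {i}, ‖X j - x‖ ^ 2 := by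
        intro u
        rw [← Finset.sum_update_of_mem (Finset.mem_univ i)]
        refine Finset.sum_congr rfl fun j _ => ?_
        rcases eq_or_ne j i with rfl | hj <;> simp [*]
      have e3 := e2 (X i)
      rw [Function.update_eq_self] at e3
      have e4 : Function.update z i (F i (X i) - F i a) = z := Function.update_eq_self i z
      simp only [hA, hB, e1, e2 y, e3] at h1
      simp only [e4]
      linarith
  · simp only [hl, ← Finset.sum_div]
    exact div_self hSpos.ne'
  · rintro rfl; simp
  · refine neg_gradient_mem_regularNormalCone (hasFDerivAt_penalty a x X hσ) ?_
    have hnear : ∀ᶠ y in 𝓝 x, ‖y - a‖ < ρ :=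
      (by fun_prop : Continuous fun y => ‖y - a‖).continuousAt.eventually
        (gt_mem_nhds hpU.1)
    filter_upwards [mem_nhdsWithin_of_mem_nhds hnear, self_mem_nhdsWithin] with y hy hyΩ
    have h1 := hpmin (y, X) ((memC _ _).2 ⟨⟨hyΩ, hy.le⟩, hpC.2⟩)
    simp only [hA, hB] at h1
    linarith
  · have e1 : ∑ i, l i • -((l i)⁻¹ • ((2 * K) • (X i - x))) = (2 * K) • ∑ i, (x - X i) := by
      rw [Finset.smul_sum]
      refine Finset.sum_congr rfl fun i _ => ?_
      rw [smul_neg, smul_inv_smul₀ (hlpos i).ne', ← smul_neg, neg_sub]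
    rw [e1]
    -- The penalty and constraint terms cancel, leaving a multiple of `x - a` whose norm is at most
    -- `ε + 2 * ρ`.
    have e2 : ∀ u v w : E, u + v + -(w + v + u) = -w := fun u v w => by abel
    rw [e2, norm_neg, norm_smul, Real.norm_of_nonneg (by positivity), add_mul]
    have h2 : ‖x - a‖ ≤ √(‖x - a‖ ^ 2 + σ ^ 2) :=
      Real.le_sqrt_of_sq_le (by linarith [sq_nonneg σ])
    have h3 : 0 < √(‖x - a‖ ^ 2 + σ ^ 2) := Real.sqrt_pos.2 (by positivity)
    have h4 : ε / √(‖x - a‖ ^ 2 + σ ^ 2) * ‖x - a‖ ≤ ε := by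
      rw [div_mul_eq_mul_div, div_le_iff₀ h3]
      gcongr
    linarith [hpU.1]

/-- Fritz John multipliers for a weak Pareto-type point `a` of `F` over `Ω`, up to the slope `ε`,
subject to the equality constraint `c * (‖x‖ ^ 2 - r) = 0`. -/
theorem exists_multipliers {F : ι → E → ℝ} (hF : ∀ i, LocallyLipschitz (F i))
    {Ω : Set E} (hΩ : IsClosed Ω) {a : E} (ha : a ∈ Ω) {ε c r δ : ℝ} (hε : 0 ≤ ε)
    (hq : c * (‖a‖ ^ 2 - r) = 0) (hδ : 0 < δ)
    (hmin : ∀ x ∈ Ω, ‖x - a‖ ≤ δ → c * (‖x‖ ^ 2 - r) = 0 →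
      ∃ i, -(ε * ‖x - a‖) ≤ F i x - F i a) :
    ∃ (V : ι → E) (l : ι → ℝ) (μ : ℝ) (w : E),
      (∀ i, V i ∈ limitingSubdifferential (F i) a) ∧ w ∈ limitingNormalCone Ω a ∧
      (∀ i, 0 ≤ l i) ∧ ∑ i, l i + |μ| = 1 ∧ (c = 0 → μ = 0) ∧
      ‖∑ i, l i • V i + μ • a + w‖ ≤ ε := by
  choose L s hs hL using fun i => hF i a
  obtain ⟨η₀, hη₀, hball⟩ : ∃ η₀ > 0, Metric.ball a η₀ ⊆ ⋂ i, s i :=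
    Metric.mem_nhds_iff.1 ((Filter.iInter_mem).2 hs)
  have hηpos : ∀ k : ℕ, 0 < η₀ * (1 / ((k : ℝ) + 1)) := fun k => by positivity
  have hηle : ∀ k : ℕ, η₀ * (1 / ((k : ℝ) + 1)) ≤ η₀ := fun k => by
    have : 1 / ((k : ℝ) + 1) ≤ 1 := by
      rw [div_le_one (by positivity)]
      linarith [Nat.cast_nonneg (α := ℝ) k]
    nlinarith
  have hη0 : Tendsto (fun k : ℕ => η₀ * (1 / ((k : ℝ) + 1))) atTop (𝓝 0) := by
    simpa using tendsto_one_div_add_atTop_nhds_zero_nat.const_mul η₀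
  choose x X V l μ w hxΩ hxa hXa hV hl hsum hμ hw hnorm using fun k : ℕ =>
    exists_fuzzy_multipliers hF hΩ ha hε hq hδ hmin (hηpos k)
  have hx : Tendsto x atTop (𝓝 a) :=
    tendsto_iff_norm_sub_tendsto_zero.2
      (squeeze_zero (fun _ => norm_nonneg _) (fun k => (hxa k).le) hη0)
  have hX : ∀ i, Tendsto (fun k => X k i) atTop (𝓝 a) := fun i =>
    tendsto_iff_norm_sub_tendsto_zero.2
      (squeeze_zero (fun _ => norm_nonneg _) (fun k => (hXa k i).le) hη0)
  have hVL : ∀ k i, ‖V k i‖ ≤ L i := fun k i => by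
    refine (hV k i).norm_le (s := s i) ?_ (hL i)
    refine mem_of_superset (Metric.isOpen_ball.mem_nhds ?_)
      (hball.trans (Set.iInter_subset s i))
    rw [Metric.mem_ball, dist_eq_norm]
    exact (hXa k i).trans_le (hηle k)
  -- The constraint multipliers `μ k` may blow up; scaling by `(1 + |μ k|)⁻¹` bounds all multipliers
  -- and still gives total mass one in the limit.
  set t : ℕ → ℝ := fun k => (1 + |μ k|)⁻¹ with ht
  have htpos : ∀ k, 0 < t k := fun k => by positivity
  have htle : ∀ k, t k ≤ 1 := fun k => inv_le_one_of_one_le₀ (by linarith [abs_nonneg (μ k)])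
  set e : ℕ → E := fun k => t k • (∑ i, l k i • V k i + μ k • x k + w k) with he
  have hele : ∀ k, ‖e k‖ ≤ ε + η₀ * (1 / ((k : ℝ) + 1)) := fun k => by
    rw [he, norm_smul, Real.norm_of_nonneg (htpos k).le]
    calc _ ≤ 1 * ‖∑ i, l k i • V k i + μ k • x k + w k‖ := by gcongr; exact htle k
      _ ≤ _ := by rw [one_mul]; exact hnorm k
  have hnormalized : ∀ k, ∑ i, t k * l k i + |t k * μ k| = 1 := fun k => by
    rw [← Finset.mul_sum, hsum, abs_mul, abs_of_pos (htpos k), ← mul_add]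
    exact inv_mul_cancel₀ (by positivity)
  have hl1 : ∀ k i, t k * l k i ≤ 1 := fun k i => by
    have := Finset.single_le_sum (f := fun i => t k * l k i)
      (fun j _ => mul_nonneg (htpos k).le (hl k j)) (Finset.mem_univ i)
    have h2 := hnormalized k
    have h3 := abs_nonneg (t k * μ k)
    linarith
  have hμ1 : ∀ k, |t k * μ k| ≤ 1 := fun k => by
    have := Finset.sum_nonneg fun i (_ : i ∈ Finset.univ) => mul_nonneg (htpos k).le (hl k i)
    linarith [hnormalized k]
  have hcpt : IsCompact ((Set.univ.pi fun i => Metric.closedBall (0 : E) (L i)) ×ˢ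
      (Set.univ.pi fun _ : ι => Set.Icc (0 : ℝ) 1) ×ˢ Set.Icc (-1 : ℝ) 1 ×ˢ
      Metric.closedBall (0 : E) (ε + η₀)) :=
    (isCompact_univ_pi fun _ => isCompact_closedBall _ _).prod
      ((isCompact_univ_pi fun _ => isCompact_Icc).prod
        (isCompact_Icc.prod (isCompact_closedBall _ _)))
  obtain ⟨⟨V', l', μ', e'⟩, -, φ, hφ, hlim⟩ := hcpt.tendsto_subseq
    (x := fun k => (V k, fun i => t k * l k i, t k * μ k, e k)) fun k => by
      refine ⟨fun i _ => by simpa using hVL k i,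
        fun i _ => ⟨mul_nonneg (htpos k).le (hl k i), hl1 k i⟩, abs_le.1 (hμ1 k), ?_⟩
      simpa using (hele k).trans (by linarith [hηle k])
  have hφt := hφ.tendsto_atTop
  have hV' : ∀ i, Tendsto (fun k => V (φ k) i) atTop (𝓝 (V' i)) := fun i =>
    (tendsto_pi_nhds.1 hlim.fst_nhds) i
  have hl' : ∀ i, Tendsto (fun k => t (φ k) * l (φ k) i) atTop (𝓝 (l' i)) := fun i =>
    (tendsto_pi_nhds.1 hlim.snd_nhds.fst_nhds) i
  have hμ' : Tendsto (fun k => t (φ k) * μ (φ k)) atTop (𝓝 μ') := hlim.snd_nhds.snd_nhds.fst_nhds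
  have he' : Tendsto (fun k => e (φ k)) atTop (𝓝 e') := hlim.snd_nhds.snd_nhds.snd_nhds
  have hxφ := hx.comp hφt
  -- No separate bound on the normals is needed: they are the scaled residual minus terms already
  -- known to converge.
  have hw' : Tendsto (fun k => t (φ k) • w (φ k)) atTop
      (𝓝 (e' - (∑ i, l' i • V' i + μ' • a))) := by
    have h1 := he'.sub ((tendsto_finsetSum Finset.univ
      fun i _ => (hl' i).smul (hV' i)).add (hμ'.smul hxφ))
    refine h1.congr fun k => ?_
    simp only [he, smul_add, Finset.smul_sum, smul_smul, Function.comp]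
    abel
  refine ⟨V', l', μ', _, fun i => ?_, ⟨x ∘ φ, fun k => t (φ k) • w (φ k), fun k => hxΩ _, hxφ,
    fun k => smul_mem_regularNormalCone (htpos _).le (hw _), hw'⟩, fun i => ?_, ?_, ?_, ?_⟩
  · exact mem_limitingSubdifferential_of_tendsto (hF i).continuous.continuousAt
      ((hX i).comp hφt) (hV' i) fun k => hV (φ k) i
  · exact ge_of_tendsto' (hl' i) fun k => mul_nonneg (htpos _).le (hl _ i)
  · have h1 := (tendsto_finsetSum Finset.univ fun i _ => hl' i).add hμ'.abs
    refine tendsto_nhds_unique (h1.congr fun k => ?_) tendsto_const_nhds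
    exact hnormalized (φ k)
  · intro hc
    refine tendsto_nhds_unique (hμ'.congr fun k => ?_) tendsto_const_nhds
    rw [hμ _ hc, mul_zero]
  · rw [add_sub_cancel]
    have h1 : Tendsto (fun k => ε + η₀ * (1 / ((φ k : ℝ) + 1))) atTop (𝓝 (ε + 0)) :=
      (hη0.comp hφt).const_add ε
    rw [add_zero] at h1
    exact le_of_tendsto_of_tendsto' he'.norm h1 fun k => hele (φ k)

end Multipliers

end NonsmoothVO

namespace NonsmoothVO

/-! ### The sublevel set and multipliers for the vector problem -/

variable {n m : ℕ} {f : EuclideanSpace ℝ (Fin n) → EuclideanSpace ℝ (Fin m)}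
  {Ω : Set (EuclideanSpace ℝ (Fin n))} {ybar : EuclideanSpace ℝ (Fin m)}

/-- The sublevel set `{x ∈ Ω | f x ≦ ybar}`. -/
def sublevelSet (f : EuclideanSpace ℝ (Fin n) → EuclideanSpace ℝ (Fin m))
    (Ω : Set (EuclideanSpace ℝ (Fin n))) (ybar : EuclideanSpace ℝ (Fin m)) :
    Set (EuclideanSpace ℝ (Fin n)) :=
  {x | x ∈ Ω ∧ Leq (f x) ybar}

theorem isClosed_sublevelSet (hf : Continuous f) (hΩ : IsClosed Ω) :
    IsClosed (sublevelSet f Ω ybar) := by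
  have : sublevelSet f Ω ybar = Ω ∩ ⋂ i, {x | f x i ≤ ybar i} := by
    ext x
    simp [sublevelSet, Leq]
  rw [this]
  exact hΩ.inter <| isClosed_iInter fun i => isClosed_le (by fun_prop) continuous_const

theorem locallyLipschitz_apply (hf : LocallyLipschitz f) (i : Fin m) :
    LocallyLipschitz fun x => f x i :=
  ((EuclideanSpace.proj (𝕜 := ℝ) i).lipschitz.locallyLipschitz).comp hf

/-- Bounded sections force bounded values along the sublevel set. -/
theorem exists_compact_of_hasBoundedSection (hb : HasBoundedSection (f '' Ω) ybar) :
    ∃ C : Set (EuclideanSpace ℝ (Fin m)), IsCompact C ∧ ∀ x ∈ sublevelSet f Ω ybar, f x ∈ C := by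
  obtain ⟨a, ha⟩ := hb
  refine ⟨WithLp.toLp 2 '' Set.Icc (WithLp.ofLp a) (WithLp.ofLp ybar),
    isCompact_Icc.image (PiLp.continuous_toLp 2 _), fun x hx => ?_⟩
  have h := ha ⟨Set.mem_image_of_mem f hx.1, hx.2⟩
  exact ⟨WithLp.ofLp (f x), ⟨fun i => h i, fun i => hx.2 i⟩, rfl⟩

theorem not_isBounded_iff_forall_exists_norm {S : Set (EuclideanSpace ℝ (Fin n))} :
    ¬ Bornology.IsBounded S ↔ ∀ R : ℝ, ∃ x ∈ S, R < ‖x‖ := by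
  rw [isBounded_iff_forall_norm_le]
  push Not
  rfl

theorem rabier_nonneg (f : EuclideanSpace ℝ (Fin n) → EuclideanSpace ℝ (Fin m))
    (Ω : Set (EuclideanSpace ℝ (Fin n))) (x : EuclideanSpace ℝ (Fin n)) : 0 ≤ rabier f Ω x := by
  refine Real.sInf_nonneg ?_
  rintro r ⟨v, w, l, -, -, -, -, rfl⟩
  exact norm_nonneg _

/-- A weak `ε`-Pareto slope condition bounds the Rabier function. -/
theorem rabier_le (hm : 1 ≤ m) (hf : LocallyLipschitz f) (hΩ : IsClosed Ω)
    {a : EuclideanSpace ℝ (Fin n)} (ha : a ∈ Ω) {ε δ : ℝ} (hε : 0 ≤ ε) (hδ : 0 < δ)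
    (hmin : ∀ x ∈ Ω, ‖x - a‖ ≤ δ → ∃ i, -(ε * ‖x - a‖) ≤ f x i - f a i) :
    rabier f Ω a ≤ ε := by
  have : Nonempty (Fin m) := ⟨⟨0, hm⟩⟩
  obtain ⟨V, l, μ, w, hV, hw, hl, hsum, hμ, hnorm⟩ :=
    exists_multipliers (F := fun i x => f x i) (locallyLipschitz_apply hf) hΩ ha
      (c := 0) (r := 0) hε (by simp) hδ fun x hx hxδ _ => hmin x hx hxδ
  have hμ0 := hμ rfl
  rw [hμ0, zero_smul, add_zero] at hnorm
  rw [hμ0, abs_zero, add_zero] at hsum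
  refine le_trans ?_ hnorm
  unfold rabier
  refine csInf_le ⟨0, ?_⟩ ⟨V, w, l, fun i => Or.inl (hV i), hw, hl, hsum, rfl⟩
  rintro r ⟨v, w, l, -, -, -, -, rfl⟩
  exact norm_nonneg _

/-- The multiplier rule with zero slope and the sphere through `a` as constraint; the sphere
contributes the term `μ • a`. -/
theorem mem_Gam_of_forall_sphere (hm : 1 ≤ m) (hf : LocallyLipschitz f) (hΩ : IsClosed Ω)
    {a : EuclideanSpace ℝ (Fin n)} (ha : a ∈ Ω)
    (hmin : ∀ x ∈ Ω, ‖x‖ = ‖a‖ → ∃ i, 0 ≤ f x i - f a i) : a ∈ Gam f Ω := by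
  have : Nonempty (Fin m) := ⟨⟨0, hm⟩⟩
  obtain ⟨V, l, μ, w, hV, hw, hl, hsum, -, hnorm⟩ :=
    exists_multipliers (F := fun i x => f x i) (locallyLipschitz_apply hf) hΩ ha
      (c := 1) (r := ‖a‖ ^ 2) (ε := 0) le_rfl (by simp) one_pos fun x hx _ hq => by
        have hx2 : ‖x‖ ^ 2 = ‖a‖ ^ 2 := by linarith
        simpa using hmin x hx ((sq_eq_sq₀ (norm_nonneg _) (norm_nonneg _)).1 hx2)
  exact ⟨ha, V, fun i => Or.inl (hV i), l, μ, hl, hsum, w, hw,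
    norm_eq_zero.1 (le_antisymm hnorm (norm_nonneg _))⟩

/-! ### Almost critical points far out in an unbounded sublevel set -/

/-- Points where the sum of the components decreases at slope at most `κ` along the sublevel set
are weak `κ`-Pareto points. -/
theorem exists_component_ge_of_sum_ge (hm : 1 ≤ m) {a x : EuclideanSpace ℝ (Fin n)}
    (ha : Leq (f a) ybar) {d : ℝ} (hd : 0 ≤ d)
    (h : Leq (f x) ybar → ∑ i, f a i ≤ ∑ i, f x i + d) : ∃ i, -d ≤ f x i - f a i := by
  by_contra! hcon
  have hle : ∀ i, f x i ≤ f a i := fun i => by linarith [hcon i]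
  have h1 := h fun i => (hle i).trans (ha i)
  let i₀ : Fin m := ⟨0, hm⟩
  have h2 : ∑ i, (f x i - f a i) ≤ f x i₀ - f a i₀ := by
    rw [← Finset.add_sum_erase _ _ (Finset.mem_univ i₀)]
    linarith [Finset.sum_nonpos (s := Finset.univ.erase i₀) (f := fun i => f x i - f a i)
      fun i _ => sub_nonpos.2 (hle i)]
  rw [Finset.sum_sub_distrib] at h2
  linarith [hcon i₀]

theorem exists_mem_Gam (hm : 1 ≤ m) (hf : LocallyLipschitz f) (hΩ : IsClosed Ω)
    (hunb : ¬ Bornology.IsBounded (sublevelSet f Ω ybar)) (R : ℝ) :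
    ∃ x ∈ sublevelSet f Ω ybar, R < ‖x‖ ∧ x ∈ Gam f Ω := by
  have hfc : Continuous f := hf.continuous
  obtain ⟨x₁, hx₁, hR⟩ := not_isBounded_iff_forall_exists_norm.1 hunb R
  have hcpt : IsCompact (sublevelSet f Ω ybar ∩ Metric.sphere 0 ‖x₁‖) :=
    (isCompact_sphere _ _).inter_left (isClosed_sublevelSet hfc hΩ)
  obtain ⟨a, ⟨haS, haR⟩, hmin⟩ := hcpt.exists_isMinOn ⟨x₁, hx₁, by simp⟩
    (f := fun x => ∑ i, f x i) (by fun_prop : Continuous fun x => ∑ i, f x i).continuousOn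
  have haR' : ‖a‖ = ‖x₁‖ := by simpa using haR
  refine ⟨a, haS, by rwa [haR'], mem_Gam_of_forall_sphere hm hf hΩ haS.1 fun x hx hxa => ?_⟩
  have := exists_component_ge_of_sum_ge (f := f) (x := x) hm haS.2 le_rfl fun hle => by
    have : ∑ i, f a i ≤ ∑ i, f x i := hmin ⟨⟨hx, hle⟩, by simp [hxa, haR']⟩
    simpa using this
  simpa using this

/-- Ekeland's principle made explicit by compactness: a near-minimizer `x₁` of the sum on a tail of
`S`, with gap `ε / 10`, is perturbed within distance `‖x₁‖ / 4`, at a slope proportional to `ε /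
‖x₁‖`. -/
theorem exists_norm_mul_rabier_le (hm : 1 ≤ m) (hf : LocallyLipschitz f) (hΩ : IsClosed Ω)
    (hb : HasBoundedSection (f '' Ω) ybar)
    (hunb : ¬ Bornology.IsBounded (sublevelSet f Ω ybar)) (R : ℝ) {ε : ℝ} (hε : 0 < ε) :
    ∃ x ∈ sublevelSet f Ω ybar, R < ‖x‖ ∧ ‖x‖ * rabier f Ω x ≤ ε := by
  have hfc : Continuous f := hf.continuous
  set S := sublevelSet f Ω ybar
  have hunb' := not_isBounded_iff_forall_exists_norm.1 hunb
  obtain ⟨b, hbd⟩ : ∃ b : ℝ, ∀ x ∈ S, b ≤ ∑ i, f x i := by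
    obtain ⟨a, ha⟩ := hb
    exact ⟨∑ i, a i, fun x hx => Finset.sum_le_sum fun i _ =>
      ha ⟨Set.mem_image_of_mem f hx.1, hx.2⟩ i⟩
  -- the infimum over the complement of a large ball is almost attained arbitrarily far away
  obtain ⟨ρ, hρR, hρ0, hρ⟩ : ∃ ρ, R ≤ ρ ∧ 0 < ρ ∧ ∀ r, ∃ x₁ ∈ S, r < ‖x₁‖ ∧
      ∀ x ∈ S, ρ ≤ ‖x‖ → ∑ i, f x₁ i ≤ ∑ i, f x i + ε / 10 := by
    -- Otherwise a lower bound for the sum on a tail rises by `ε / 10` on a further tail; iteration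
    -- exceeds `∑ i, ybar i`, although every tail of `S` is nonempty.
    by_contra! hcon
    have step : ∀ N : ℕ, ∃ r, max R 1 ≤ r ∧ ∀ x ∈ S, r ≤ ‖x‖ → b + N * (ε / 10) ≤ ∑ i, f x i := by
      intro N
      induction N with
      | zero => exact ⟨max R 1, le_rfl, fun x hx _ => by simpa using hbd x hx⟩
      | succ N ih =>
        obtain ⟨r, hr, hrN⟩ := ih
        obtain ⟨r', hr'⟩ := hcon r ((le_max_left _ _).trans hr)
          (lt_of_lt_of_le one_pos ((le_max_right _ _).trans hr))
        refine ⟨max r (r' + 1), hr.trans (le_max_left _ _), fun x hx hxr => ?_⟩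
        obtain ⟨x', hx', hx'r, hlt⟩ := hr' x hx (by linarith [le_max_right r (r' + 1)])
        have := hrN x' hx' hx'r
        push_cast
        linarith
    obtain ⟨x₀, hx₀, -⟩ := hunb' 0
    obtain ⟨N, hN⟩ := exists_nat_gt ((∑ i, ybar i - b) / (ε / 10))
    rw [div_lt_iff₀ (by positivity)] at hN
    obtain ⟨r, -, hr⟩ := step N
    obtain ⟨x, hx, hxr⟩ := hunb' r
    have h1 := hr x hx hxr.le
    have h2 : ∑ i, f x i ≤ ∑ i, ybar i := Finset.sum_le_sum fun i _ => hx.2 i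
    linarith
  obtain ⟨x₁, hx₁, hx₁ρ, hx₁min⟩ := hρ (2 * ρ)
  have hx₁0 : 0 < ‖x₁‖ := by linarith
  -- Chosen so that `κ * (‖x₁‖ / 4) = ε / 10`, which matches the gap, while `κ * (5 / 4 * ‖x₁‖) = ε
  -- / 2`.
  set κ := 2 * ε / (5 * ‖x₁‖) with hκ
  have hκ0 : 0 < κ := by positivity
  set C := S ∩ {x | ρ ≤ ‖x‖} ∩ Metric.closedBall x₁ (‖x₁‖ / 2)
  have hcpt : IsCompact C := (isCompact_closedBall _ _).inter_left
    ((isClosed_sublevelSet hfc hΩ).inter (isClosed_le continuous_const continuous_norm))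
  have hx₁C : x₁ ∈ C := ⟨⟨hx₁, by simp only [Set.mem_ofPred_eq]; linarith⟩,
    Metric.mem_closedBall_self (by positivity)⟩
  obtain ⟨a, ⟨⟨haS, haρ⟩, -⟩, hmin⟩ := hcpt.exists_isMinOn ⟨x₁, hx₁C⟩
    (f := fun x => ∑ i, f x i + κ * ‖x - x₁‖) (by fun_prop : Continuous _).continuousOn
  have h1 : ∑ i, f a i + κ * ‖a - x₁‖ ≤ ∑ i, f x₁ i := by simpa using hmin hx₁C
  have h2 := hx₁min a haS haρ
  have h3 : ‖a - x₁‖ ≤ ‖x₁‖ / 4 := by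
    have : κ * ‖a - x₁‖ ≤ κ * (‖x₁‖ / 4) := by
      have : κ * (‖x₁‖ / 4) = ε / 10 := by rw [hκ]; field_simp; norm_num
      linarith
    exact le_of_mul_le_mul_left this hκ0
  have h4 : ‖x₁‖ - ‖a‖ ≤ ‖x₁‖ / 4 := by
    have := norm_sub_norm_le x₁ a
    rw [norm_sub_rev] at this
    linarith
  have h5 : ‖a‖ ≤ 5 / 4 * ‖x₁‖ := by
    have := norm_sub_norm_le a x₁
    linarith
  refine ⟨a, haS, by linarith, ?_⟩
  have hrab : rabier f Ω a ≤ κ := by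
    refine rabier_le hm hf hΩ haS.1 hκ0.le (δ := ‖x₁‖ / 4) (by positivity) fun x hx hxδ => ?_
    refine exists_component_ge_of_sum_ge hm haS.2 (by positivity) fun hle => ?_
    have h6 : ‖a‖ - ‖x‖ ≤ ‖x₁‖ / 4 := by
      have := norm_sub_norm_le a x
      rw [norm_sub_rev] at this
      linarith
    have h7 : ‖x - x₁‖ ≤ ‖x - a‖ + ‖a - x₁‖ := norm_sub_le_norm_sub_add_norm_sub _ _ _
    -- Two displacements of at most `‖x₁‖ / 4` stay in the ball of radius `‖x₁‖ / 2`, and leave norm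
    -- at least `‖x₁‖ / 2 > ρ`.
    have hxC : x ∈ C := by
      refine ⟨⟨⟨hx, hle⟩, ?_⟩, ?_⟩
      · simp only [Set.mem_ofPred_eq]; linarith
      · rw [Metric.mem_closedBall, dist_eq_norm]; linarith
    have h8 : ∑ i, f a i + κ * ‖a - x₁‖ ≤ ∑ i, f x i + κ * ‖x - x₁‖ := hmin hxC
    have := mul_le_mul_of_nonneg_left h7 hκ0.le
    linarith
  calc ‖a‖ * rabier f Ω a ≤ (5 / 4 * ‖x₁‖) * κ :=
        mul_le_mul h5 hrab (rabier_nonneg _ _ _) (by positivity)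
    _ ≤ ε := by rw [hκ]; field_simp; norm_num

/-! ### Each condition versus boundedness of the sublevel set -/

theorem IsProperAtSublevel.of_isBounded (h : Bornology.IsBounded (sublevelSet f Ω ybar)) :
    IsProperAtSublevel f Ω ybar := by
  intro x hx hn hle
  obtain ⟨R, hR⟩ := isBounded_iff_forall_norm_le.1 h
  obtain ⟨k, hk⟩ := (hn.eventually_gt_atTop R).exists
  exact absurd (hR _ ⟨hx k, hle k⟩) (not_le.2 hk)

theorem IsProperAtSublevel.isBounded (hb : HasBoundedSection (f '' Ω) ybar)
    (h : IsProperAtSublevel f Ω ybar) : Bornology.IsBounded (sublevelSet f Ω ybar) := by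
  by_contra hunb
  choose x hx hxn using fun k : ℕ => not_isBounded_iff_forall_exists_norm.1 hunb k
  have hn : Tendsto (fun k => ‖x k‖) atTop atTop :=
    tendsto_atTop_mono (fun k => (hxn k).le) tendsto_natCast_atTop_atTop
  obtain ⟨C, hC, hfC⟩ := exists_compact_of_hasBoundedSection hb
  obtain ⟨R, hR⟩ := isBounded_iff_forall_norm_le.1 hC.isBounded
  obtain ⟨k, hk⟩ := ((h x (fun k => (hx k).1) hn fun k => (hx k).2).eventually_gt_atTop R).exists
  exact absurd (hR _ (hfC _ (hx k))) (not_le.2 hk)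

/-- From points of the sublevel set arbitrarily far away with a property `P k`, extract a
sequence along which `f` converges. -/
theorem exists_seq_tendsto (hb : HasBoundedSection (f '' Ω) ybar)
    {P : ℕ → EuclideanSpace ℝ (Fin n) → Prop}
    (h : ∀ k : ℕ, ∃ x ∈ sublevelSet f Ω ybar, (k : ℝ) < ‖x‖ ∧ P k x) :
    ∃ (y : EuclideanSpace ℝ (Fin m)) (x : ℕ → EuclideanSpace ℝ (Fin n)) (φ : ℕ → ℕ),
      StrictMono φ ∧ (∀ k, x k ∈ sublevelSet f Ω ybar) ∧
      Tendsto (fun k => ‖x k‖) atTop atTop ∧ Tendsto (fun k => f (x k)) atTop (𝓝 y) ∧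
      ∀ k, P (φ k) (x k) := by
  choose x hx hxn hP using h
  obtain ⟨C, hC, hfC⟩ := exists_compact_of_hasBoundedSection hb
  obtain ⟨y, -, φ, hφ, hlim⟩ := hC.tendsto_subseq fun k => hfC _ (hx k)
  have hn : Tendsto (fun k => ‖x k‖) atTop atTop :=
    tendsto_atTop_mono (fun k => (hxn k).le) tendsto_natCast_atTop_atTop
  exact ⟨y, x ∘ φ, φ, hφ, fun k => hx _, hn.comp hφ.tendsto_atTop, hlim, fun k => hP _⟩

/-- Once `‖x‖ ≥ 1`, the weighted Rabier value dominates the unweighted one. -/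
theorem PalaisSmale.weakPalaisSmale (h : PalaisSmale f Ω ybar) : WeakPalaisSmale f Ω ybar := by
  refine Set.eq_empty_of_forall_notMem ?_
  rintro y ⟨x, hx, hle, hn, hy, hlim⟩
  refine Set.eq_empty_iff_forall_notMem.1 h y ⟨x, hx, hle, hn, hy, ?_⟩
  refine squeeze_zero' (Eventually.of_forall fun k => rabier_nonneg _ _ _) ?_ hlim
  filter_upwards [hn.eventually_ge_atTop 1] with k hk
  exact le_mul_of_one_le_left (rabier_nonneg _ _ _) hk

theorem WeakPalaisSmale.isBounded (hm : 1 ≤ m) (hf : LocallyLipschitz f) (hΩ : IsClosed Ω)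
    (hb : HasBoundedSection (f '' Ω) ybar) (h : WeakPalaisSmale f Ω ybar) :
    Bornology.IsBounded (sublevelSet f Ω ybar) := by
  by_contra hunb
  obtain ⟨y, x, φ, hφ, hx, hn, hy, hP⟩ := exists_seq_tendsto hb
    (P := fun k x => ‖x‖ * rabier f Ω x ≤ 1 / ((k : ℝ) + 1))
    fun k => exists_norm_mul_rabier_le hm hf hΩ hb hunb k (by positivity)
  refine Set.eq_empty_iff_forall_notMem.1 h y
    ⟨x, fun k => (hx k).1, fun k => (hx k).2, hn, hy, ?_⟩
  exact squeeze_zero (fun k => mul_nonneg (norm_nonneg _) (rabier_nonneg _ _ _)) hP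
    (tendsto_one_div_add_atTop_nhds_zero_nat.comp hφ.tendsto_atTop)

theorem MTame.isBounded (hm : 1 ≤ m) (hf : LocallyLipschitz f) (hΩ : IsClosed Ω)
    (hb : HasBoundedSection (f '' Ω) ybar) (h : MTame f Ω ybar) :
    Bornology.IsBounded (sublevelSet f Ω ybar) := by
  by_contra hunb
  obtain ⟨y, x, φ, hφ, hx, hn, hy, hP⟩ := exists_seq_tendsto hb (P := fun _ x => x ∈ Gam f Ω)
    fun k => exists_mem_Gam hm hf hΩ hunb k
  exact Set.eq_empty_iff_forall_notMem.1 h y ⟨x, hP, fun k => (hx k).2, hn, hy⟩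

theorem PalaisSmale.of_isBounded (h : Bornology.IsBounded (sublevelSet f Ω ybar)) :
    PalaisSmale f Ω ybar := by
  refine Set.eq_empty_of_forall_notMem ?_
  rintro y ⟨x, hx, hle, hn, hy, -⟩
  exact not_tendsto_nhds_of_tendsto_atTop
    (IsProperAtSublevel.of_isBounded h x hx hn hle) _ hy.norm

theorem MTame.of_isBounded (h : Bornology.IsBounded (sublevelSet f Ω ybar)) :
    MTame f Ω ybar := by
  refine Set.eq_empty_of_forall_notMem ?_
  rintro y ⟨x, hx, hle, hn, hy⟩
  exact not_tendsto_nhds_of_tendsto_atTop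
    (IsProperAtSublevel.of_isBounded h x (fun k => (hx k).1) hn hle) _ hy.norm

theorem isCompact_sectionAt (hf : Continuous f) (hΩ : IsClosed Ω)
    (h : Bornology.IsBounded (sublevelSet f Ω ybar)) : IsCompact (sectionAt (f '' Ω) ybar) := by
  have hc : IsCompact (sublevelSet f Ω ybar) :=
    Metric.isCompact_of_isClosed_isBounded (isClosed_sublevelSet hf hΩ) h
  convert hc.image hf using 1
  ext z
  constructor
  · rintro ⟨⟨x, hx, rfl⟩, hz⟩
    exact ⟨x, ⟨hx, hz⟩, rfl⟩
  · rintro ⟨x, ⟨hx, hz⟩, rfl⟩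
    exact ⟨⟨x, hx, rfl⟩, hz⟩

end NonsmoothVO

theorem theorem3p1 {n m : ℕ} (hm : 1 ≤ m)
    (f : EuclideanSpace ℝ (Fin n) → EuclideanSpace ℝ (Fin m)) (hf : LocallyLipschitz f)
    (Ω : Set (EuclideanSpace ℝ (Fin n))) (hΩ : IsClosed Ω)
    (ybar : EuclideanSpace ℝ (Fin m)) (hy : ybar ∈ f '' Ω)
    (hb : NonsmoothVO.HasBoundedSection (f '' Ω) ybar) :
    List.TFAE [NonsmoothVO.IsProperAtSublevel f Ω ybar,
      NonsmoothVO.PalaisSmale f Ω ybar,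
      NonsmoothVO.WeakPalaisSmale f Ω ybar,
      NonsmoothVO.MTame f Ω ybar] ∧
    ((NonsmoothVO.IsProperAtSublevel f Ω ybar ∨ NonsmoothVO.PalaisSmale f Ω ybar ∨
        NonsmoothVO.WeakPalaisSmale f Ω ybar ∨ NonsmoothVO.MTame f Ω ybar) →
      (NonsmoothVO.sectionAt (f '' Ω) ybar).Nonempty ∧
      IsCompact (NonsmoothVO.sectionAt (f '' Ω) ybar)) := by
  have tfae : List.TFAE [NonsmoothVO.IsProperAtSublevel f Ω ybar,
      NonsmoothVO.PalaisSmale f Ω ybar,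
      NonsmoothVO.WeakPalaisSmale f Ω ybar,
      NonsmoothVO.MTame f Ω ybar] := by
    tfae_have 1 → 2 := fun h => .of_isBounded (h.isBounded hb)
    tfae_have 2 → 3 := fun h => h.weakPalaisSmale
    tfae_have 3 → 1 := fun h => .of_isBounded (h.isBounded hm hf hΩ hb)
    tfae_have 1 → 4 := fun h => .of_isBounded (h.isBounded hb)
    tfae_have 4 → 1 := fun h => .of_isBounded (h.isBounded hm hf hΩ hb)
    tfae_finish
  refine ⟨tfae, fun h => ⟨⟨ybar, hy, fun _ => le_rfl⟩, ?_⟩⟩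
  have hp : NonsmoothVO.IsProperAtSublevel f Ω ybar := by
    rcases h with h | h | h | h
    · exact h
    · exact (tfae.out 1 0).1 h
    · exact (tfae.out 2 0).1 h
    · exact (tfae.out 3 0).1 h
  exact NonsmoothVO.isCompact_sectionAt hf.continuous hΩ (hp.isBounded hb)
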